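/- Let $X$ be an infinite-dimensional complex Banach space and let $T$ be a bounded linear operator on $X$, with spectrum $\sigma(T)$. For an operator $S$, write $N(S)$ and $R(S)$ for its kernel and range; $a(S)$ and $\delta(S)$ denote the ascent and descent, i.e. the least $n\ge 0$ with $N(S^n)=N(S^{n+1})$, respectively $R(S^n)=R(S^{n+1})$ (and $\infty$ if there is no such $n$). A bounded operator is called Weyl if it is Fredholm (closed range, finite-dimensional kernel and cokernel) of index $0$. It is called B-Weyl if, for some integer $n\ge 0$, $R(S^n)$ is closed and the restriction of $S$ to an operator $R(S^n)\to R(S^n)$ is Weyl. Put - $\sigma_W(T)=\{\lambda\in\mathbb C: T-\lambda I\text{ is not Weyl}\}$ and $\sigma_{BW}(T)=\{\lambda\in\mathbb C: T-\lambda I\text{ is not B-Weyl}\}$; - $\sigma_a(T)=\{\lambda\in\mathbb C: T-\lambda I\text{ is not bounded below}\}$; - $\Pi^0(T)$ (poles of finite rank): the set of $\lambda\in\sigma(T)$ such that $a(T-\lambda I)<\infty$, $\delta(T-\lambda I)<\infty$ and $\dim N(T-\lambda I)<\infty$; - $\Pi_a(T)$ (left poles): the set of $\lambda\in\sigma_a(T)$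 such that $a(T-\lambda I)<\infty$ and $R\big((T-\lambda I)^{a(T-\lambda I)+1}\big)$ is closed; - $\Pi_a^0(T)$ (left poles of finite rank): the set of $\lambda\in\Pi_a(T)$ with $\dim N(T-\lambda I)<\infty$. Then the following statements are equivalent: (i) $T$ satisfies property $(Z_{\Pi_a})$, i.e. $\sigma(T)\setminus\sigma_W(T)=\Pi_a(T)$; (ii) $T$ satisfies property $(gab)$, i.e. $\sigma(T)\setminus\sigma_{BW}(T)=\Pi_a(T)$, and $\sigma_{BW}(T)=\sigma_W(T)$; (iii) $T$ satisfies property $(ab)$, i.e. $\sigma(T)\setminus\sigma_W(T)=\Pi_a^0(T)$, and $\Pi_a(T)=\Pi_a^0(T)$; (iv) $T$ satisfies property $(Bab)$, i.e. $\sigma(T)\setminus\sigma_{BW}(T)=\Pi_a^0(T)$, and $\Pi_a(T)=\Pi_a^0(T)$; (v) $T$ satisfies Browder's theorem, i.e. $\sigma(T)\setminus\sigma_W(T)=\Pi^0(T)$, and $\Pi_a(T)=\Pi^0(T)$. -/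

import Mathlib

namespace WeylType

variable {X : Type*} [NormedAddCommGroup X] [NormedSpace ℂ X]

/-- The index `dim N(S) - codim R(S)` of an operator (meaningful for Fredholm operators). For a
Fredholm operator `R(S)` is closed, so that `codim R(S) = dim N(S*)`. -/
noncomputable def index (S : X →L[ℂ] X) : ℤ :=
  (Module.finrank ℂ S.ker : ℤ) - (Module.finrank ℂ (X ⧸ S.range) : ℤ)

/-- A Weyl operator: a Fredholm operator of index `0`. -/
def IsWeyl (S : X →L[ℂ] X) : Prop :=
  S.IsFredholm ∧ index S = 0

theorem mapsTo_range_pow (S : X →L[ℂ] X) (n : ℕ) :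
    ∀ x ∈ (S ^ n).range, S x ∈ (S ^ n).range := by
  rintro _ ⟨y, rfl⟩
  refine ⟨S y, ?_⟩
  change (S ^ n * S) y = (S * S ^ n) y
  rw [← pow_succ, ← pow_succ']

/-- The operator `S_[n]`: the restriction of `S` to a bounded operator of `R(S ^ n)` to itself. -/
def restrictRange (S : X →L[ℂ] X) (n : ℕ) : (S ^ n).range →L[ℂ] (S ^ n).range :=
  S.restrict (mapsTo_range_pow S n)

/-- A B-Weyl operator: for some `n`, the range `R(S ^ n)` is closed and `S_[n]` is Weyl. -/
def IsBWeyl (S : X →L[ℂ] X) : Prop :=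
  ∃ n : ℕ, IsClosed ((S ^ n).range : Set X) ∧ IsWeyl (restrictRange S n)

/-- The ascent: the least `n` with `N(S ^ n) = N(S ^ (n + 1))`, or `⊤` if there is none. -/
noncomputable def ascent (S : X →L[ℂ] X) : ℕ∞ :=
  sInf ((fun n : ℕ => (n : ℕ∞)) '' {n : ℕ | (S ^ n).ker = (S ^ (n + 1)).ker})

/-- The descent: the least `n` with `R(S ^ n) = R(S ^ (n + 1))`, or `⊤` if there is none. -/
noncomputable def descent (S : X →L[ℂ] X) : ℕ∞ :=
  sInf ((fun n : ℕ => (n : ℕ∞)) '' {n : ℕ | (S ^ n).range = (S ^ (n + 1)).range})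

/-- The operator is bounded below. -/
def IsBoundedBelow (S : X →L[ℂ] X) : Prop :=
  ∃ c : ℝ, 0 < c ∧ ∀ x : X, c * ‖x‖ ≤ ‖S x‖

/-- The operator `T - μ I`. -/
def shift (T : X →L[ℂ] X) (μ : ℂ) : X →L[ℂ] X :=
  T - μ • ContinuousLinearMap.id ℂ X

/-- The Weyl spectrum `σ_W(T)`. -/
def weylSpectrum (T : X →L[ℂ] X) : Set ℂ := {μ | ¬ IsWeyl (shift T μ)}

/-- The B-Weyl spectrum `σ_BW(T)`. -/
def bWeylSpectrum (T : X →L[ℂ] X) : Set ℂ := {μ | ¬ IsBWeyl (shift T μ)}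

/-- The approximate point spectrum `σ_a(T)`. -/
def approxPointSpectrum (T : X →L[ℂ] X) : Set ℂ := {μ | ¬ IsBoundedBelow (shift T μ)}

/-- The poles `Π(T)`: points `μ` of the spectrum at which `T - μ I` has finite ascent and finite
descent. -/
def poles (T : X →L[ℂ] X) : Set ℂ :=
  {μ | μ ∈ spectrum ℂ T ∧ ascent (shift T μ) < ⊤ ∧ descent (shift T μ) < ⊤}

/-- The poles of finite rank `Π⁰(T)`: poles `μ` with `dim N(T - μ I) < ∞`. -/
def polesFiniteRank (T : X →L[ℂ] X) : Set ℂ :=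
  {μ | μ ∈ poles T ∧ FiniteDimensional ℂ (shift T μ).ker}

/-- The left poles `Π_a(T)`: points `μ` of the approximate point spectrum at which `T - μ I` has
finite ascent `n` and `R((T - μ I) ^ (n + 1))` is closed. -/
def leftPoles (T : X →L[ℂ] X) : Set ℂ :=
  {μ | μ ∈ approxPointSpectrum T ∧
    ∃ n : ℕ, ascent (shift T μ) = n ∧ IsClosed ((shift T μ ^ (n + 1)).range : Set X)}

/-- The left poles of finite rank `Π_a⁰(T)`: left poles `μ` with `dim N(T - μ I) < ∞`. -/
def leftPolesFiniteRank (T : X →L[ℂ] X) : Set ℂ :=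
  {μ | μ ∈ leftPoles T ∧ FiniteDimensional ℂ (shift T μ).ker}

/-- Property `(Z_{Π_a})`. -/
def PropertyZPiA (T : X →L[ℂ] X) : Prop := spectrum ℂ T \ weylSpectrum T = leftPoles T

/-- Property `(gab)`. -/
def PropertyGab (T : X →L[ℂ] X) : Prop := spectrum ℂ T \ bWeylSpectrum T = leftPoles T

/-- Property `(ab)`. -/
def PropertyAb (T : X →L[ℂ] X) : Prop := spectrum ℂ T \ weylSpectrum T = leftPolesFiniteRank T

/-- Property `(Bab)`. -/
def PropertyBab (T : X →L[ℂ] X) : Prop := spectrum ℂ T \ bWeylSpectrum T = leftPolesFiniteRank T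

/-- Browder's theorem holds for `T`. -/
def BrowderTheorem (T : X →L[ℂ] X) : Prop := spectrum ℂ T \ weylSpectrum T = polesFiniteRank T

end WeylType

/-! Property (i) is the hub of the equivalences. The hard implication is (i) to (ii): a B-Weyl point
μ of the spectrum has to be a left pole, hence, by (i), a Weyl point. By `IsBWeyl.range_pow_eq` and
`IsBWeyl.isUnit`, finite ascent at μ suffices for a left pole. Suppose the ascent at μ is infinite.
Then every small z is an eigenvalue of T - μ, while T - μ - z is Weyl for small z ≠ 0. Such points μ
+ z are Weyl points of the spectrum, so (i) gives them finite ascent; but a Weyl operator of finite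
ascent has no small nonzero eigenvalues, a contradiction (`exists_ker_pow_eq_of_isBWeyl`). The index
theory behind this is algebraic: on a Banach space, Weyl means that kernel and cokernel have equal
finite dimension, equivalently that the operator is invertible plus finite rank. B-Weyl operators
are reached through the restriction to R(S^n), since S - z with z ≠ 0 is bijective modulo R(S^n). -/

namespace LinearMap

/-! ### Linear algebra: index zero, ascent and descent -/

variable {K V : Type*} [Field K] [AddCommGroup V] [Module K V]

/-- If `L` leaves `U` invariant and induces an injective map on the quotient by `U`, then `L` and
its restriction to `U` have the same kernel. -/
theorem nonempty_ker_restrict_equiv (L : V →ₗ[K] V) (U : Submodule K V)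
    (hU : ∀ x ∈ U, L x ∈ U) (hinj : ∀ x, L x ∈ U → x ∈ U) :
    Nonempty ((L.restrict hU).ker ≃ₗ[K] L.ker) := by
  refine ⟨LinearEquiv.ofBijective ((U.subtype.domRestrict (L.restrict hU).ker).codRestrict L.ker
    fun x => ?_) ⟨fun x y h => ?_, fun y => ?_⟩⟩
  · have := x.2
    rw [mem_ker, Subtype.ext_iff] at this
    exact this
  · exact Subtype.ext (Subtype.ext (Subtype.ext_iff.1 h :))
  · have hy : L y = 0 := y.2
    have hyU : (y : V) ∈ U := hinj _ (by rw [hy]; exact U.zero_mem)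
    exact ⟨⟨⟨y, hyU⟩, by rw [mem_ker, Subtype.ext_iff]; exact hy⟩, rfl⟩

/-- If `L` leaves `U` invariant and induces a bijective map on the quotient by `U`, then `L` and
its restriction to `U` have the same cokernel. -/
theorem nonempty_cokernel_restrict_equiv (L : V →ₗ[K] V) (U : Submodule K V)
    (hU : ∀ x ∈ U, L x ∈ U) (hinj : ∀ x, L x ∈ U → x ∈ U) (hsurj : ∀ y, ∃ x, y - L x ∈ U) :
    Nonempty ((U ⧸ (L.restrict hU).range) ≃ₗ[K] (V ⧸ L.range)) := by
  have hker : (L.range.mkQ.comp U.subtype).ker = (L.restrict hU).range := by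
    ext u
    rw [mem_ker, comp_apply, Submodule.mkQ_apply, Submodule.Quotient.mk_eq_zero]
    constructor
    · rintro ⟨x, hx⟩
      exact ⟨⟨x, hinj x (by rw [hx]; exact u.2)⟩, Subtype.ext hx⟩
    · rintro ⟨x, rfl⟩
      exact ⟨x, rfl⟩
  refine ⟨(Submodule.quotEquivOfEq _ _ hker.symm).trans
    (quotKerEquivOfSurjective (L.range.mkQ.comp U.subtype) fun q => ?_)⟩
  obtain ⟨y, rfl⟩ := L.range.mkQ_surjective q
  obtain ⟨x, hx⟩ := hsurj y
  refine ⟨⟨_, hx⟩, ?_⟩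
  rw [comp_apply, Submodule.mkQ_apply, Submodule.mkQ_apply, Submodule.Quotient.eq]
  exact ⟨-x, by simp⟩

/-- The kernel and the cokernel are finite-dimensional of the same dimension. -/
def HasIndexZero (L : V →ₗ[K] V) : Prop :=
  FiniteDimensional K L.ker ∧ FiniteDimensional K (V ⧸ L.range) ∧
    Module.finrank K L.ker = Module.finrank K (V ⧸ L.range)

theorem hasIndexZero_restrict_iff (L : V →ₗ[K] V) (U : Submodule K V)
    (hU : ∀ x ∈ U, L x ∈ U) (hinj : ∀ x, L x ∈ U → x ∈ U) (hsurj : ∀ y, ∃ x, y - L x ∈ U) :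
    (L.restrict hU).HasIndexZero ↔ L.HasIndexZero := by
  obtain ⟨e⟩ := nonempty_ker_restrict_equiv L U hU hinj
  obtain ⟨f⟩ := nonempty_cokernel_restrict_equiv L U hU hinj hsurj
  unfold HasIndexZero
  rw [e.finrank_eq, f.finrank_eq]
  exact and_congr (Module.Finite.equiv_iff e) (and_congr_left' (Module.Finite.equiv_iff f))

theorem hasIndexZero_of_finiteDimensional [FiniteDimensional K V] (L : V →ₗ[K] V) :
    L.HasIndexZero := by
  refine ⟨inferInstance, inferInstance, ?_⟩
  have h1 := L.finrank_range_add_finrank_ker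
  have h2 := L.range.finrank_quotient_add_finrank
  omega

/-- `L` acts as the identity modulo the finite-dimensional range of `L - 1`, so the index can be
computed on that range. -/
theorem hasIndexZero_of_hasFiniteRange_sub_one {L : V →ₗ[K] V} (h : (L - 1).HasFiniteRange) :
    L.HasIndexZero := by
  have : FiniteDimensional K (L - 1).range := Module.Finite.of_fg h
  have key : ∀ x, L x - x ∈ (L - 1).range := fun x => ⟨x, rfl⟩
  have hU : ∀ x ∈ (L - 1).range, L x ∈ (L - 1).range := fun x hx => by
    simpa using add_mem (key x) hx
  rw [← hasIndexZero_restrict_iff L (L - 1).range hU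
    (fun x hx => by simpa using sub_mem hx (key x))
    (fun y => ⟨y, by simpa using neg_mem (key y)⟩)]
  exact hasIndexZero_of_finiteDimensional _

theorem hasIndexZero_of_hasFiniteRange_sub {L : V →ₗ[K] V} (A : V ≃ₗ[K] V)
    (h : (L - A.toLinearMap).HasFiniteRange) : L.HasIndexZero := by
  have h1 : (L ∘ₗ A.symm.toLinearMap - 1).HasFiniteRange := by
    rw [show L ∘ₗ A.symm.toLinearMap - 1 = (L - A.toLinearMap) ∘ₗ A.symm.toLinearMap by ext; simp]
    exact h.comp_right _
  obtain ⟨hk, hc, he⟩ := hasIndexZero_of_hasFiniteRange_sub_one h1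
  have hr : (L ∘ₗ A.symm.toLinearMap).range = L.range := by
    rw [range_comp, LinearEquiv.range, Submodule.map_top]
  have e : (L ∘ₗ A.symm.toLinearMap).ker ≃ₗ[K] L.ker :=
    (LinearEquiv.ofEq _ _ (by
      ext x
      simp [Submodule.mem_map_equiv])).trans (A.submoduleMap L.ker).symm
  rw [hr] at hc he
  exact ⟨(Module.Finite.equiv_iff e).1 hk, hc, e.finrank_eq ▸ he⟩

theorem HasIndexZero.surjective {L : V →ₗ[K] V} (h : L.HasIndexZero) (hL : L.ker = ⊥) :
    L.range = ⊤ := by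
  obtain ⟨_, _, he⟩ := h
  rw [hL, finrank_bot, eq_comm, Module.finrank_zero_iff] at he
  exact Submodule.Quotient.subsingleton_iff.1 he

theorem pow_ker_eq_of_le {L : V →ₗ[K] V} {p : ℕ} (h : (L ^ p).ker = (L ^ (p + 1)).ker) {q : ℕ}
    (hq : p ≤ q) {x : V} (hx : (L ^ q) x = 0) : (L ^ p) x = 0 := by
  induction q, hq using Nat.le_induction with
  | base => exact hx
  | succ q hq ih =>
    apply ih
    have h1 : (L ^ (q - p)) x ∈ (L ^ (p + 1)).ker := by
      rw [mem_ker, ← Module.End.mul_apply, ← pow_add, show p + 1 + (q - p) = q + 1 by omega]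
      exact hx
    rw [← h, mem_ker, ← Module.End.mul_apply, ← pow_add, show p + (q - p) = q by omega] at h1
    exact h1

theorem pow_range_eq_of_le {L : V →ₗ[K] V} {q : ℕ} (h : (L ^ q).range = (L ^ (q + 1)).range)
    {m : ℕ} (hm : q ≤ m) : (L ^ m).range = (L ^ q).range := by
  induction m, hm using Nat.le_induction with
  | base => rfl
  | succ m hm ih =>
    rw [← ih]
    obtain ⟨k, rfl⟩ := Nat.exists_eq_add_of_le hm
    rw [show q + k + 1 = k + (q + 1) by omega, add_comm q k, pow_add L k (q + 1), pow_add L k q,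
      Module.End.mul_eq_comp, Module.End.mul_eq_comp, range_comp, range_comp, h]

/-- If the ascent is at most `p` and the descent is finite, then the descent is at most `p`. -/
theorem pow_range_eq_of_ascent {L : V →ₗ[K] V} {p q : ℕ} (hp : (L ^ p).ker = (L ^ (p + 1)).ker)
    (hq : (L ^ q).range = (L ^ (q + 1)).range) : (L ^ p).range = (L ^ (p + 1)).range := by
  rcases le_or_gt q p with h | h
  · rw [pow_range_eq_of_le hq h, pow_range_eq_of_le hq (by omega : q ≤ p + 1)]
  apply le_antisymm
  · rintro _ ⟨x, rfl⟩
    obtain ⟨z, hz⟩ : (L ^ q) x ∈ (L ^ (q + 1)).range := hq ▸ ⟨x, rfl⟩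
    refine ⟨z, ?_⟩
    have h0 : (L ^ p) (x - L z) = 0 := pow_ker_eq_of_le hp h.le (by
      rw [map_sub, ← hz, pow_succ, Module.End.mul_apply, sub_self])
    rw [map_sub, sub_eq_zero] at h0
    rw [h0, pow_succ, Module.End.mul_apply]
  · rintro _ ⟨x, rfl⟩
    exact ⟨L x, by rw [pow_succ, Module.End.mul_apply]⟩

theorem finiteDimensional_ker_pow {L : V →ₗ[K] V} (h : FiniteDimensional K L.ker) (p : ℕ) :
    FiniteDimensional K (L ^ p).ker := by
  induction p with
  | zero =>
    rw [pow_zero, Module.End.one_eq_id, ker_id]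
    infer_instance
  | succ p ih =>
    have hm : ∀ x ∈ (L ^ (p + 1)).ker, L x ∈ (L ^ p).ker := fun x hx => by
      rwa [mem_ker, pow_succ, Module.End.mul_apply] at hx
    have hk : FiniteDimensional K (L.restrict hm).ker := by
      refine FiniteDimensional.of_injective
        (((L ^ (p + 1)).ker.subtype.domRestrict (L.restrict hm).ker).codRestrict L.ker
          fun x => ?_) fun x y h => ?_
      · have := x.2
        rw [mem_ker, Subtype.ext_iff] at this
        exact this
      · exact Subtype.ext (Subtype.ext (Subtype.ext_iff.1 h :))
    have hr : FiniteDimensional K (L.restrict hm).range := inferInstance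
    have := (L.restrict hm).quotKerEquivRange.symm.finiteDimensional
    exact Module.Finite.of_submodule_quotient (L.restrict hm).ker

/-- Finite ascent and descent and a finite-dimensional kernel force index zero. -/
theorem hasIndexZero_of_ascent_descent {L : V →ₗ[K] V} {p q : ℕ}
    (hp : (L ^ p).ker = (L ^ (p + 1)).ker) (hq : (L ^ q).range = (L ^ (q + 1)).range)
    (h : FiniteDimensional K L.ker) : L.HasIndexZero := by
  have := finiteDimensional_ker_pow h p
  have hr := pow_range_eq_of_ascent hp hq
  have hU : ∀ x ∈ (L ^ p).ker, L x ∈ (L ^ p).ker := fun x hx => by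
    rw [mem_ker, ← Module.End.mul_apply, ← pow_succ, ← mem_ker, ← hp]
    exact hx
  rw [← hasIndexZero_restrict_iff L (L ^ p).ker hU
    (fun x hx => by rwa [hp, mem_ker, pow_succ, Module.End.mul_apply])
    (fun y => ?_)]
  · exact hasIndexZero_of_finiteDimensional _
  · obtain ⟨x, hx⟩ : (L ^ p) y ∈ (L ^ (p + 1)).range := hr ▸ ⟨y, rfl⟩
    refine ⟨x, ?_⟩
    rw [mem_ker, map_sub, ← hx, pow_succ, Module.End.mul_apply, sub_self]

end LinearMap

namespace WeylType

open Filter Topology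

/-! ### Weyl operators: perturbation, powers and nearby eigenvalues -/

section Banach

variable {X : Type*} [NormedAddCommGroup X] [NormedSpace ℂ X]

theorem IsWeyl.hasIndexZero {S : X →L[ℂ] X} (h : IsWeyl S) : S.toLinearMap.HasIndexZero :=
  ⟨h.1.finite_ker, h.1.finite_coker, by exact_mod_cast sub_eq_zero.1 h.2⟩

theorem range_pow_antitone (S : X →L[ℂ] X) : Antitone fun m : ℕ => (S ^ m).range :=
  antitone_nat_of_succ_le fun m => by
    rintro _ ⟨x, rfl⟩
    exact ⟨S x, by rw [pow_succ]; rfl⟩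

theorem isWeyl_of_hasFiniteRange_sub {S A : X →L[ℂ] X} (hA : IsUnit A)
    (h : (S - A).toLinearMap.HasFiniteRange) : IsWeyl S := by
  obtain ⟨u, rfl⟩ := hA
  have hl : ∀ x, u⁻¹.val (u.val x) = x := fun x => congrArg (fun f : X →L[ℂ] X => f x) u.inv_mul
  have hr : ∀ x, u.val (u⁻¹.val x) = x := fun x => congrArg (fun f : X →L[ℂ] X => f x) u.mul_inv
  obtain ⟨hk, hc, he⟩ := LinearMap.hasIndexZero_of_hasFiniteRange_sub
    (LinearEquiv.ofLinearMap u.val.toLinearMap u⁻¹.val.toLinearMap (LinearMap.ext hr)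
      (LinearMap.ext hl)) (L := S.toLinearMap) h
  refine ⟨.of_isQuasiInverse (v := u⁻¹.val) ⟨?_, ?_⟩, by unfold index; rw [he, sub_self]⟩
  · refine LinearMap.FiniteRangeSetoid.equiv_iff_hasFiniteRange.2 ?_
    rw [show u⁻¹.val.toLinearMap ∘ₗ S.toLinearMap - .id = u⁻¹.val.toLinearMap ∘ₗ (S - u.val).toLinearMap
      from LinearMap.ext fun x => by simp [hl]]
    exact h.comp_left _
  · refine LinearMap.FiniteRangeSetoid.equiv_iff_hasFiniteRange.2 ?_
    rw [show S.toLinearMap ∘ₗ u⁻¹.val.toLinearMap - .id = (S - u.val).toLinearMap ∘ₗ u⁻¹.val.toLinearMap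
      from LinearMap.ext fun x => by simp [hr]]
    exact h.comp_right _

theorem isWeyl_of_isUnit {S : X →L[ℂ] X} (h : IsUnit S) : IsWeyl S :=
  isWeyl_of_hasFiniteRange_sub h (by rw [sub_self]; exact .zero)

variable [CompleteSpace X]

/-- An operator of index zero is a finite rank perturbation of an invertible operator. -/
theorem exists_isUnit_hasFiniteRange_sub {S : X →L[ℂ] X} (h : S.toLinearMap.HasIndexZero) :
    ∃ A : X →L[ℂ] X, IsUnit A ∧ (S - A).toLinearMap.HasFiniteRange := by
  obtain ⟨_, _, he⟩ := h
  obtain ⟨P, hP⟩ := Submodule.ClosedComplemented.of_finiteDimensional S.ker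
  obtain ⟨C, hC⟩ := S.range.exists_isCompl
  let q := Submodule.quotientEquivOfIsCompl S.range C hC
  have : FiniteDimensional ℂ C := q.finiteDimensional
  let e : S.ker ≃ₗ[ℂ] C := LinearEquiv.ofFinrankEq _ _ (he.trans q.finrank_eq)
  let G : S.ker →L[ℂ] X := (C.subtype ∘ₗ e.toLinearMap).toContinuousLinearMap
  have hG : ∀ x, G x = e x := fun x => rfl
  -- `G ∘L P` maps the kernel isomorphically onto a complement of the range, repairing both defects
  -- of `S` at once.
  refine ⟨S + G ∘L P, ContinuousLinearMap.isUnit_iff_bijective.2 ⟨?_, ?_⟩, ?_⟩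
  · refine (injective_iff_map_eq_zero (S + G ∘L P)).2 fun x hx => ?_
    have hx' : S x + e (P x) = 0 := hx
    have h0 : (e (P x) : X) = 0 := by
      refine Submodule.disjoint_def.1 hC.disjoint _ ⟨-x, ?_⟩ (e (P x)).2
      rw [map_neg]
      exact neg_eq_of_add_eq_zero_right hx'
    have h1 : P x = 0 := e.map_eq_zero_iff.1 (Subtype.ext h0)
    have h2 : S x = 0 := by simpa [h0] using hx'
    have h3 := hP ⟨x, h2⟩
    rw [h1] at h3
    exact (Subtype.ext_iff.1 h3).symm
  · intro y
    obtain ⟨_, ⟨u, rfl⟩, c, hc, rfl⟩ := Submodule.mem_sup.1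
      (hC.sup_eq_top ▸ Submodule.mem_top : y ∈ S.range ⊔ C)
    refine ⟨u - P u + (e.symm ⟨c, hc⟩ : S.ker), ?_⟩
    have h1 : S (P u) = 0 := (P u).2
    have h2 : S (e.symm ⟨c, hc⟩ : S.ker) = 0 := (e.symm ⟨c, hc⟩).2
    simp [hP, hG, h1, h2]
  · rw [sub_add_cancel_left]
    change (-(G.toLinearMap ∘ₗ P.toLinearMap)).HasFiniteRange
    exact (LinearMap.HasFiniteRange.of_finite_dom.comp_right _).neg

/-- Closed range need not be assumed: it comes with the decomposition into invertible plus finite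
rank. -/
theorem isWeyl_iff_hasIndexZero {S : X →L[ℂ] X} :
    IsWeyl S ↔ S.toLinearMap.HasIndexZero := by
  refine ⟨IsWeyl.hasIndexZero, fun h => ?_⟩
  obtain ⟨A, hA, hF⟩ := exists_isUnit_hasFiniteRange_sub h
  exact isWeyl_of_hasFiniteRange_sub hA hF

theorem IsWeyl.isUnit {S : X →L[ℂ] X} (h : IsWeyl S) (hk : S.ker = ⊥) : IsUnit S :=
  ContinuousLinearMap.isUnit_iff_bijective.2
    ⟨LinearMap.ker_eq_bot.1 hk, LinearMap.range_eq_top.1 (h.hasIndexZero.surjective hk)⟩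

theorem IsWeyl.pow {S : X →L[ℂ] X} (h : IsWeyl S) (k : ℕ) : IsWeyl (S ^ k) := by
  obtain ⟨A, hA, hF⟩ := exists_isUnit_hasFiniteRange_sub h.hasIndexZero
  refine isWeyl_of_hasFiniteRange_sub (hA.pow k) ?_
  induction k with
  | zero =>
    rw [pow_zero, pow_zero, sub_self]
    exact .zero
  | succ k ih =>
    rw [show S ^ (k + 1) - A ^ (k + 1) = S ^ k * (S - A) + (S ^ k - A ^ k) * A by
      rw [pow_succ, pow_succ]; noncomm_ring]
    exact (hF.comp_left (S ^ k).toLinearMap).add (ih.comp_right A.toLinearMap)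

theorem eventually_isUnit_sub_smul {A : X →L[ℂ] X} (hA : IsUnit A) :
    ∀ᶠ z : ℂ in 𝓝 0, IsUnit (A - z • ContinuousLinearMap.id ℂ X) := by
  have hc : Continuous fun z : ℂ => A - z • ContinuousLinearMap.id ℂ X := by fun_prop
  refine hc.continuousAt.eventually (Units.isOpen.mem_nhds ?_)
  simpa using hA

theorem IsWeyl.eventually_sub_smul {S : X →L[ℂ] X} (h : IsWeyl S) :
    ∀ᶠ z : ℂ in 𝓝 0, IsWeyl (S - z • ContinuousLinearMap.id ℂ X) := by
  obtain ⟨A, hA, hF⟩ := exists_isUnit_hasFiniteRange_sub h.hasIndexZero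
  filter_upwards [eventually_isUnit_sub_smul hA] with z hz
  refine isWeyl_of_hasFiniteRange_sub hz ?_
  rwa [sub_sub_sub_cancel_right]

/-- All powers have index zero, so equal kernels give equal codimensions of two nested ranges. -/
theorem IsWeyl.range_pow_eq {S : X →L[ℂ] X} (h : IsWeyl S) {p : ℕ}
    (hp : (S ^ p).ker = (S ^ (p + 1)).ker) : (S ^ p).range = (S ^ (p + 1)).range := by
  obtain ⟨-, _, h1⟩ := (h.pow p).hasIndexZero
  obtain ⟨-, _, h2⟩ := (h.pow (p + 1)).hasIndexZero
  have hle : (S ^ (p + 1)).range ≤ (S ^ p).range := range_pow_antitone S p.le_succ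
  rw [hp, h2] at h1
  refine (hle.antisymm ?_).symm
  have hs : Function.Injective (Submodule.factor hle) :=
    (LinearMap.injective_iff_surjective_of_finrank_eq_finrank h1).2
      (Submodule.factor_surjective hle)
  intro y hy
  rw [← Submodule.Quotient.mk_eq_zero] at hy ⊢
  exact hs (by rw [map_zero]; exact hy)

/-- A surjective operator with nonzero finite-dimensional kernel has, under small scalar
perturbations, nonzero kernel. -/
theorem eventually_exists_eigenvector_of_surjective {S : X →L[ℂ] X}
    (hS : Function.Surjective S) [FiniteDimensional ℂ S.ker] {x : X} (hx : S x = 0) (hx0 : x ≠ 0) :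
    ∀ᶠ z : ℂ in 𝓝 0, ∃ y ≠ 0, S y = z • y := by
  obtain ⟨M, hM⟩ := (Submodule.ClosedComplemented.of_finiteDimensional S.ker).exists_isTopCompl
  have hMc : IsClosed (M : Set X) := hM.isClosed'
  have : CompleteSpace M := hMc.completeSpace_coe
  let f : M →L[ℂ] X := S ∘L M.subtypeL
  have hfk : f.ker = ⊥ := by
    rw [LinearMap.ker_eq_bot']
    intro m hm
    exact Subtype.ext (Submodule.disjoint_def.1 hM.isCompl.disjoint _ hm m.2)
  have hfr : f.range = ⊤ := by
    rw [LinearMap.range_eq_top]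
    intro y
    obtain ⟨w, rfl⟩ := hS y
    obtain ⟨k, hk, m, hm, rfl⟩ := Submodule.mem_sup.1
      (hM.isCompl.sup_eq_top ▸ Submodule.mem_top : w ∈ S.ker ⊔ M)
    have hk' : S k = 0 := hk
    exact ⟨⟨m, hm⟩, by simp [f, hk']⟩
  let e := ContinuousLinearEquiv.ofBijective f hfk hfr
  -- A bounded right inverse of `S`. Solving y - zBy = x and applying `S` gives Sy = zy.
  let B : X →L[ℂ] X := M.subtypeL ∘L e.symm.toContinuousLinearMap
  have hB : ∀ y, S (B y) = y := fun y => e.apply_symm_apply y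
  have hc : Continuous fun z : ℂ => 1 - z • B := by fun_prop
  have hev : ∀ᶠ z : ℂ in 𝓝 0, IsUnit (1 - z • B) :=
    hc.continuousAt.eventually (Units.isOpen.mem_nhds (by simp))
  filter_upwards [hev] with z hz
  obtain ⟨y, hy⟩ := (ContinuousLinearMap.isUnit_iff_bijective.1 hz).2 x
  have hy' : y - z • B y = x := hy
  refine ⟨y, ?_, ?_⟩
  · rintro rfl
    exact hx0 (by simpa using hy'.symm)
  · rw [← hy', map_sub, map_smul, hB, sub_eq_zero] at hx
    exact hx

/-- Restrict to the closed subspace Z = ⋂ R(S^m). The decreasing subspaces N(S) ∩ R(S^m) of the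
finite-dimensional kernel stabilize; this makes S : Z → Z surjective and leaves a nonzero kernel
vector in Z, so the surjective case applies. -/
theorem IsWeyl.eventually_exists_eigenvector {S : X →L[ℂ] X} (h : IsWeyl S)
    (hS : ∀ m : ℕ, S.ker ⊓ (S ^ m).range ≠ ⊥) :
    ∀ᶠ z : ℂ in 𝓝 0, ∃ y ≠ 0, S y = z • y := by
  have hk : FiniteDimensional ℂ S.ker := h.1.finite_ker
  have hanti := range_pow_antitone S
  obtain ⟨m₀, hm₀⟩ : ∃ m₀, ∀ m, m₀ ≤ m →
      S.ker ⊓ (S ^ m₀).range ≤ S.ker ⊓ (S ^ m).range := by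
    have hanti' : Antitone fun m : ℕ => ((S ^ m).range).comap S.ker.subtype :=
      fun a b hab => Submodule.comap_mono (hanti hab)
    obtain ⟨m₀, hm₀⟩ := IsArtinian.monotone_stabilizes
      (⟨fun m => OrderDual.toDual (((S ^ m).range).comap S.ker.subtype),
        fun a b hab => hanti' hab⟩ : ℕ →o (Submodule ℂ S.ker)ᵒᵈ)
    refine ⟨m₀, fun m hm x hx => ⟨hx.1, ?_⟩⟩
    have h1 : ((S ^ m₀).range).comap S.ker.subtype = ((S ^ m).range).comap S.ker.subtype :=
      hm₀ m hm
    have h2 : (⟨x, hx.1⟩ : S.ker) ∈ ((S ^ m₀).range).comap S.ker.subtype := hx.2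
    rw [h1] at h2
    exact h2
  let Z : Submodule ℂ X := ⨅ m : ℕ, (S ^ m).range
  have hZmem : ∀ {x}, x ∈ Z ↔ ∀ m : ℕ, x ∈ (S ^ m).range := Submodule.mem_iInf _
  have hZc : IsClosed (Z : Set X) := by
    rw [Submodule.coe_iInf]
    exact isClosed_iInter fun m => (h.pow m).1.isClosed_range
  have : CompleteSpace Z := hZc.completeSpace_coe
  have hSZ : ∀ x ∈ Z, S x ∈ Z := fun x hx =>
    hZmem.2 fun m => mapsTo_range_pow S m x (hZmem.1 hx m)
  let R : Z →L[ℂ] Z := S.restrict hSZ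
  have hRs : Function.Surjective R := by
    rintro ⟨y, hy⟩
    obtain ⟨u, hu⟩ := hZmem.1 hy (m₀ + 1)
    have hxy : S ((S ^ m₀) u) = y := by
      rw [← hu, pow_succ']
      rfl
    refine ⟨⟨(S ^ m₀) u, hZmem.2 fun m => ?_⟩, Subtype.ext hxy⟩
    rcases le_total m m₀ with hm | hm
    · exact hanti hm ⟨u, rfl⟩
    · obtain ⟨v, hv⟩ := hZmem.1 hy (m + 1)
      have hvy : S ((S ^ m) v) = y := by
        rw [← hv, pow_succ']
        rfl
      -- Two preimages of y differ by a kernel vector in R(S^m₀), which by stabilization lies in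
      -- R(S^m).
      have hd : (S ^ m₀) u - (S ^ m) v ∈ S.ker ⊓ (S ^ m₀).range := by
        refine ⟨?_, sub_mem ⟨u, rfl⟩ (hanti hm ⟨v, rfl⟩)⟩
        change S _ = 0
        rw [map_sub, hxy, hvy, sub_self]
      simpa using add_mem (hm₀ m hm hd).2 (⟨v, rfl⟩ : (S ^ m) v ∈ (S ^ m).range)
  have hRk : FiniteDimensional ℂ R.ker := by
    refine FiniteDimensional.of_injective ((Z.subtype.domRestrict R.ker).codRestrict S.ker
      fun x => ?_) fun x y hxy => ?_
    · have := x.2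
      rw [LinearMap.mem_ker, Subtype.ext_iff] at this
      exact this
    · exact Subtype.ext (Subtype.ext (Subtype.ext_iff.1 hxy :))
  obtain ⟨x, hx, hx0⟩ := Submodule.exists_mem_ne_zero_of_ne_bot (hS m₀)
  have hxZ : x ∈ Z := hZmem.2 fun m => by
    rcases le_total m m₀ with hm | hm
    · exact hanti hm hx.2
    · exact (hm₀ m hm hx).2
  have := eventually_exists_eigenvector_of_surjective hRs (x := ⟨x, hxZ⟩)
    (Subtype.ext hx.1) (fun h0 => hx0 (Subtype.ext_iff.1 h0))
  filter_upwards [this] with z ⟨y, hy0, hy⟩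
  exact ⟨y, fun h0 => hy0 (Subtype.ext h0), Subtype.ext_iff.1 hy⟩

/-- A Weyl operator of finite ascent has no small nonzero eigenvalues. -/
theorem IsWeyl.eventually_injective_of_ascent {S : X →L[ℂ] X} (h : IsWeyl S) {p : ℕ}
    (hp : (S ^ p).ker = (S ^ (p + 1)).ker) :
    ∀ᶠ z : ℂ in 𝓝 0, z ≠ 0 → ∀ y, S y = z • y → y = 0 := by
  have hr := h.range_pow_eq hp
  have hcl : IsClosed ((S ^ p).range : Set X) := (h.pow p).1.isClosed_range
  have : CompleteSpace (S ^ p).range := hcl.completeSpace_coe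
  -- Ascent and descent at most p make `S` bijective on R(S^p), where any eigenvector with z ≠ 0
  -- must lie.
  have hu : IsUnit (restrictRange S p) := by
    refine ContinuousLinearMap.isUnit_iff_bijective.2 ⟨?_, ?_⟩
    · refine (injective_iff_map_eq_zero _).2 ?_
      rintro ⟨_, x, rfl⟩ hx
      have h1 : x ∈ (S ^ (p + 1)).ker := by
        rw [pow_succ']
        exact Subtype.ext_iff.1 hx
      rw [← hp] at h1
      exact Subtype.ext h1
    · rintro ⟨y, hy⟩
      obtain ⟨x, rfl⟩ := hr ▸ hy
      exact ⟨⟨(S ^ p) x, x, rfl⟩,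
        Subtype.ext (congrArg (fun f : X →L[ℂ] X => f x) (pow_succ' S p).symm)⟩
  filter_upwards [eventually_isUnit_sub_smul hu] with z hz hz0 y hy
  have hpow : ∀ k : ℕ, (S ^ k) y = z ^ k • y := by
    intro k
    induction k with
    | zero => simp
    | succ k ih =>
      rw [pow_succ', mul_apply_eq_comp, ih, map_smul, hy, smul_smul, pow_succ]
  have hyr : y ∈ (S ^ p).range := ⟨(z ^ p)⁻¹ • y, by
    change (S ^ p) _ = y
    rw [map_smul, hpow, smul_smul, inv_mul_cancel₀ (pow_ne_zero _ hz0), one_smul]⟩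
  have h0 := (ContinuousLinearMap.isUnit_iff_bijective.1 hz).1 (a₁ := ⟨y, hyr⟩) (a₂ := 0) (by
    rw [map_zero]
    refine Subtype.ext ?_
    change S y - z • y = 0
    rw [hy, sub_self])
  exact Subtype.ext_iff.1 h0

end Banach

/-! ### Restriction to R(S^n) and B-Weyl operators -/

section Restriction

variable {X : Type*} [NormedAddCommGroup X] [NormedSpace ℂ X]

theorem restrictRange_pow_apply (S : X →L[ℂ] X) (n q : ℕ) (x : (S ^ n).range) :
    ((restrictRange S n ^ q) x : X) = (S ^ q) x := by
  induction q with
  | zero => rfl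
  | succ q ih =>
    rw [pow_succ', pow_succ', mul_apply_eq_comp, mul_apply_eq_comp, ← ih]
    rfl

theorem map_range_restrictRange_pow (S : X →L[ℂ] X) (n q : ℕ) :
    (restrictRange S n ^ q).range.map (S ^ n).range.subtype = (S ^ (n + q)).range := by
  ext y
  constructor
  · rintro ⟨_, ⟨⟨_, x, rfl⟩, rfl⟩, rfl⟩
    exact ⟨x, by rw [add_comm, pow_add]; exact (restrictRange_pow_apply S n q ⟨_, x, rfl⟩).symm⟩
  · rintro ⟨x, rfl⟩
    refine ⟨_, ⟨⟨(S ^ n) x, x, rfl⟩, rfl⟩, ?_⟩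
    rw [add_comm, pow_add]
    exact restrictRange_pow_apply S n q _

theorem ker_pow_eq_of_restrictRange {S : X →L[ℂ] X} {n m : ℕ}
    (h : (restrictRange S n).ker ⊓ (restrictRange S n ^ m).range = ⊥) :
    (S ^ (n + m)).ker = (S ^ (n + m + 1)).ker := by
  apply le_antisymm
  · intro x hx
    have hx' : (S ^ (n + m)) x = 0 := hx
    rw [pow_succ']
    change S ((S ^ (n + m)) x) = 0
    rw [hx', map_zero]
  · intro x hx
    have h1 : S ((S ^ (n + m)) x) = 0 := by
      rw [pow_succ'] at hx
      exact hx
    obtain ⟨y, hy, hyx⟩ : (S ^ (n + m)) x ∈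
        (restrictRange S n ^ m).range.map (S ^ n).range.subtype := by
      rw [map_range_restrictRange_pow]
      exact ⟨x, rfl⟩
    have h2 : y ∈ (restrictRange S n).ker ⊓ (restrictRange S n ^ m).range := by
      refine ⟨Subtype.ext ?_, hy⟩
      rw [← hyx] at h1
      exact h1
    rw [h, Submodule.mem_bot] at h2
    rw [h2, map_zero] at hyx
    exact hyx.symm

theorem restrictRange_ker_pow_eq {S : X →L[ℂ] X} {p : ℕ} (hp : (S ^ p).ker = (S ^ (p + 1)).ker)
    (n : ℕ) : (restrictRange S n ^ p).ker = (restrictRange S n ^ (p + 1)).ker := by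
  ext x
  have h1 : ((x : X) ∈ (S ^ p).ker) ↔ (x : X) ∈ (S ^ (p + 1)).ker := by rw [hp]
  rw [LinearMap.mem_ker, LinearMap.mem_ker, Subtype.ext_iff, Subtype.ext_iff]
  change ((restrictRange S n ^ p) x : X) = 0 ↔ ((restrictRange S n ^ (p + 1)) x : X) = 0
  rw [restrictRange_pow_apply, restrictRange_pow_apply]
  exact h1

/-- `S` is nilpotent modulo R(S^n), so S - z is bijective there for z ≠ 0; this is the injective
half. The identity zx = Sx - (Sx - zx) lifts x one range at a time. -/
theorem mem_range_pow_of_sub_smul_mem {S : X →L[ℂ] X} {z : ℂ} (hz : z ≠ 0) {n : ℕ} {x : X}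
    (hx : S x - z • x ∈ (S ^ n).range) : x ∈ (S ^ n).range := by
  have key : ∀ k ≤ n, x ∈ (S ^ k).range := by
    intro k
    induction k with
    | zero => exact fun _ => ⟨x, rfl⟩
    | succ k ih =>
      intro hk
      have h1 : S x ∈ (S ^ (k + 1)).range := by
        obtain ⟨u, hu⟩ := ih (by omega)
        exact ⟨u, by rw [pow_succ', ← hu]; rfl⟩
      have h2 := (S ^ (k + 1)).range.smul_mem z⁻¹ (sub_mem h1 (range_pow_antitone S hk hx))
      rwa [sub_sub_cancel, inv_smul_smul₀ hz] at h2
  exact key n le_rfl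

theorem exists_sub_sub_smul_mem_range_pow (S : X →L[ℂ] X) {z : ℂ} (hz : z ≠ 0) (n : ℕ) (y : X) :
    ∃ x, y - (S x - z • x) ∈ (S ^ n).range := by
  induction n with
  | zero => exact ⟨0, _, rfl⟩
  | succ n ih =>
    obtain ⟨x, w, hw⟩ := ih
    have hw' : (S ^ n) w = y - (S x - z • x) := hw
    -- The correction cancels the remainder S^n w and leaves z⁻¹ S^(n+1) w.
    refine ⟨x - z⁻¹ • (S ^ n) w, z⁻¹ • w, ?_⟩
    have h1 : (S ^ (n + 1)) (z⁻¹ • w) = z⁻¹ • S ((S ^ n) w) := by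
      rw [map_smul, pow_succ']
      rfl
    change (S ^ (n + 1)) (z⁻¹ • w) = _
    rw [h1, map_sub, map_smul, smul_sub, smul_inv_smul₀ hz]
    generalize S ((S ^ n) w) = v
    rw [hw']
    abel

theorem hasIndexZero_restrictRange_sub_smul_iff (S : X →L[ℂ] X) {z : ℂ} (hz : z ≠ 0) (n : ℕ) :
    (restrictRange S n - z • ContinuousLinearMap.id ℂ (S ^ n).range).toLinearMap.HasIndexZero ↔
      (S - z • ContinuousLinearMap.id ℂ X).toLinearMap.HasIndexZero :=
  LinearMap.hasIndexZero_restrict_iff (S - z • ContinuousLinearMap.id ℂ X).toLinearMap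
    (S ^ n).range
    (fun x hx => sub_mem (mapsTo_range_pow S n x hx) ((S ^ n).range.smul_mem z hx))
    (fun _ hx => mem_range_pow_of_sub_smul_mem hz hx)
    (exists_sub_sub_smul_mem_range_pow S hz n)

variable [CompleteSpace X] {S : X →L[ℂ] X}

theorem IsWeyl.isBWeyl (h : IsWeyl S) : IsBWeyl S := by
  have hc : IsClosed ((S ^ 0).range : Set X) := (h.pow 0).1.isClosed_range
  have : CompleteSpace (S ^ 0).range := hc.completeSpace_coe
  exact ⟨0, hc, isWeyl_iff_hasIndexZero.2 ((LinearMap.hasIndexZero_restrict_iff S.toLinearMap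
    (S ^ 0).range (mapsTo_range_pow S 0) (fun x _ => ⟨x, rfl⟩)
    (fun _ => ⟨0, _, rfl⟩)).2 h.hasIndexZero)⟩

theorem IsBWeyl.isUnit (h : IsBWeyl S) (hk : S.ker = ⊥) : IsUnit S := by
  obtain ⟨n, hc, hW⟩ := h
  have : CompleteSpace (S ^ n).range := hc.completeSpace_coe
  have hinj : Function.Injective S := LinearMap.ker_eq_bot.1 hk
  have hu := hW.isUnit (LinearMap.ker_eq_bot.2 fun x y hxy =>
    Subtype.ext (hinj (Subtype.ext_iff.1 hxy)))
  refine ContinuousLinearMap.isUnit_iff_bijective.2 ⟨hinj, fun y => ?_⟩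
  obtain ⟨⟨_, x, rfl⟩, hx⟩ := (ContinuousLinearMap.isUnit_iff_bijective.1 hu).2 ⟨(S ^ n) y, y, rfl⟩
  have hx' : S ((S ^ n) x) = (S ^ n) y := Subtype.ext_iff.1 hx
  have hn : Function.Injective (S ^ n) := by
    rw [FunLike.coe_pow_eq_iterate]
    exact hinj.iterate n
  refine ⟨x, hn ?_⟩
  rw [← hx', ← mul_apply_eq_comp, ← mul_apply_eq_comp, ← pow_succ, pow_succ']

/-- For a B-Weyl operator, finite ascent implies the same bound for the descent. -/
theorem IsBWeyl.range_pow_eq (h : IsBWeyl S) {p : ℕ} (hp : (S ^ p).ker = (S ^ (p + 1)).ker) :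
    (S ^ p).range = (S ^ (p + 1)).range ∧ IsClosed ((S ^ (p + 1)).range : Set X) := by
  obtain ⟨n, hc, hW⟩ := h
  have : CompleteSpace (S ^ n).range := hc.completeSpace_coe
  have h1 := hW.range_pow_eq (restrictRange_ker_pow_eq hp n)
  have h2 : (S ^ (n + p)).range = (S ^ (n + p + 1)).range := by
    rw [add_assoc, ← map_range_restrictRange_pow, ← map_range_restrictRange_pow, h1]
  have h3 : (S ^ p).range = (S ^ (p + 1)).range := by
    simp only [ContinuousLinearMap.toLinearMap_pow] at hp h2 ⊢
    exact LinearMap.pow_range_eq_of_ascent hp h2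
  refine ⟨h3, ?_⟩
  have h4 : (S ^ (n + p)).range = (S ^ p).range := by
    simp only [ContinuousLinearMap.toLinearMap_pow] at h3 ⊢
    exact LinearMap.pow_range_eq_of_le h3 (by omega)
  -- The range in question equals R(S^(n+p)), the image of the closed range of a Weyl power inside
  -- the closed subspace R(S^n).
  rw [← h3, ← h4, ← map_range_restrictRange_pow]
  exact hc.isClosedEmbedding_subtypeVal.isClosedMap _ (hW.pow p).1.isClosed_range

theorem IsBWeyl.eventually_isWeyl (h : IsBWeyl S) :
    ∀ᶠ z : ℂ in 𝓝 0, z ≠ 0 → IsWeyl (S - z • ContinuousLinearMap.id ℂ X) := by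
  obtain ⟨n, hc, hW⟩ := h
  have : CompleteSpace (S ^ n).range := hc.completeSpace_coe
  filter_upwards [hW.eventually_sub_smul] with z hz hz0
  exact isWeyl_iff_hasIndexZero.2
    ((hasIndexZero_restrictRange_sub_smul_iff S hz0 n).1 hz.hasIndexZero)

/-- A B-Weyl operator of infinite ascent has all small scalars as eigenvalues. -/
theorem IsBWeyl.ascent_or_eventually_eigenvector (h : IsBWeyl S) :
    (∃ p : ℕ, (S ^ p).ker = (S ^ (p + 1)).ker) ∨
      ∀ᶠ z : ℂ in 𝓝 0, ∃ y ≠ 0, S y = z • y := by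
  obtain ⟨n, hc, hW⟩ := h
  have : CompleteSpace (S ^ n).range := hc.completeSpace_coe
  by_cases hm : ∃ m : ℕ, (restrictRange S n).ker ⊓ (restrictRange S n ^ m).range = ⊥
  · obtain ⟨m, hm⟩ := hm
    exact .inl ⟨_, ker_pow_eq_of_restrictRange hm⟩
  · right
    filter_upwards [hW.eventually_exists_eigenvector (not_exists.1 hm)] with z ⟨y, hy0, hy⟩
    exact ⟨y, fun h0 => hy0 (Subtype.ext h0), Subtype.ext_iff.1 hy⟩

end Restriction

/-! ### Finiteness of ascent and descent -/

section AscentDescent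

variable {X : Type*} [NormedAddCommGroup X] [NormedSpace ℂ X] {S : X →L[ℂ] X}

theorem sInf_image_natCast_lt_top_iff {s : Set ℕ} :
    sInf ((fun n : ℕ => (n : ℕ∞)) '' s) < ⊤ ↔ s.Nonempty := by
  simp [sInf_lt_iff, Set.Nonempty]

theorem ascent_lt_top_iff : ascent S < ⊤ ↔ ∃ p : ℕ, (S ^ p).ker = (S ^ (p + 1)).ker :=
  sInf_image_natCast_lt_top_iff

theorem descent_lt_top_iff : descent S < ⊤ ↔ ∃ q : ℕ, (S ^ q).range = (S ^ (q + 1)).range :=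
  sInf_image_natCast_lt_top_iff

theorem ker_pow_eq_of_ascent_eq {p : ℕ} (h : ascent S = p) :
    (S ^ p).ker = (S ^ (p + 1)).ker := by
  have hne : {n : ℕ | (S ^ n).ker = (S ^ (n + 1)).ker}.Nonempty :=
    sInf_image_natCast_lt_top_iff.1 (show ascent S < ⊤ by rw [h]; exact ENat.natCast_lt_top p)
  obtain ⟨m, hm, hmp⟩ := csInf_mem (hne.image fun n : ℕ => (n : ℕ∞))
  have h' : (m : ℕ∞) = p := hmp.trans h
  obtain rfl : m = p := by exact_mod_cast h'
  exact hm

theorem IsBoundedBelow.ker_eq_bot (h : IsBoundedBelow S) : S.ker = ⊥ := by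
  obtain ⟨c, hc, hS⟩ := h
  refine LinearMap.ker_eq_bot'.2 fun x hx => ?_
  have h1 := hS x
  have hx' : S x = 0 := hx
  rw [hx', norm_zero] at h1
  exact norm_le_zero_iff.1 (nonpos_of_mul_nonpos_right h1 hc)

end AscentDescent

/-! ### Weyl points, B-Weyl points and poles -/

section Spectra

variable {X : Type*} [NormedAddCommGroup X] [NormedSpace ℂ X] {T : X →L[ℂ] X} {μ : ℂ}

theorem mem_spectrum_iff : μ ∈ spectrum ℂ T ↔ ¬ IsUnit (shift T μ) := by
  rw [spectrum.mem_iff, Algebra.algebraMap_eq_smul_one, ← IsUnit.neg_iff, neg_sub]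
  rfl

theorem shift_sub_smul_id (T : X →L[ℂ] X) (μ z : ℂ) :
    shift T μ - z • ContinuousLinearMap.id ℂ X = shift T (μ + z) := by
  rw [shift, shift, sub_sub, add_smul]

theorem notMem_weylSpectrum_iff : μ ∉ weylSpectrum T ↔ IsWeyl (shift T μ) := not_not

theorem notMem_bWeylSpectrum_iff : μ ∉ bWeylSpectrum T ↔ IsBWeyl (shift T μ) := not_not

theorem mem_spectrum_of_ker_ne_bot (h : (shift T μ).ker ≠ ⊥) : μ ∈ spectrum ℂ T :=
  mem_spectrum_iff.2 fun ⟨u, hu⟩ => h (LinearMap.ker_eq_bot'.2 fun x hx => by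
    rw [← hu] at hx
    have h1 := congrArg u⁻¹.val (show u.val x = 0 from hx)
    rwa [← mul_apply_eq_comp, Units.inv_mul, map_zero] at h1)

theorem exists_ker_pow_eq_of_mem_leftPoles (h : μ ∈ leftPoles T) :
    ∃ p : ℕ, (shift T μ ^ p).ker = (shift T μ ^ (p + 1)).ker := by
  obtain ⟨-, p, hp, -⟩ := h
  exact ⟨p, ker_pow_eq_of_ascent_eq hp⟩

theorem leftPolesFiniteRank_subset_leftPoles : leftPolesFiniteRank T ⊆ leftPoles T :=
  fun _ h => h.1

variable [CompleteSpace X]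

theorem bWeylSpectrum_subset_weylSpectrum : bWeylSpectrum T ⊆ weylSpectrum T :=
  fun _ h hW => h hW.isBWeyl

theorem polesFiniteRank_subset : polesFiniteRank T ⊆ spectrum ℂ T \ weylSpectrum T := by
  rintro μ ⟨⟨hσ, ha, hd⟩, hk⟩
  obtain ⟨p, hp⟩ := ascent_lt_top_iff.1 ha
  obtain ⟨q, hq⟩ := descent_lt_top_iff.1 hd
  refine ⟨hσ, notMem_weylSpectrum_iff.2 (isWeyl_iff_hasIndexZero.2 ?_)⟩
  simp only [ContinuousLinearMap.toLinearMap_pow] at hp hq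
  exact LinearMap.hasIndexZero_of_ascent_descent hp hq hk

theorem mem_polesFiniteRank (hσ : μ ∈ spectrum ℂ T) (hB : IsBWeyl (shift T μ))
    (ha : ∃ p : ℕ, (shift T μ ^ p).ker = (shift T μ ^ (p + 1)).ker)
    (hk : FiniteDimensional ℂ (shift T μ).ker) : μ ∈ polesFiniteRank T := by
  refine ⟨⟨hσ, ascent_lt_top_iff.2 ha, descent_lt_top_iff.2 ?_⟩, hk⟩
  obtain ⟨p, hp⟩ := ha
  exact ⟨p, (hB.range_pow_eq hp).1⟩

theorem mem_leftPoles_of_isBWeyl (hσ : μ ∈ spectrum ℂ T) (hB : IsBWeyl (shift T μ))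
    (ha : ∃ p : ℕ, (shift T μ ^ p).ker = (shift T μ ^ (p + 1)).ker) : μ ∈ leftPoles T := by
  obtain ⟨p, hp⟩ := ENat.ne_top_iff_exists.1 (ascent_lt_top_iff.2 ha).ne
  exact ⟨fun hb => mem_spectrum_iff.1 hσ (hB.isUnit hb.ker_eq_bot), p, hp.symm,
    (hB.range_pow_eq (ker_pow_eq_of_ascent_eq hp.symm)).2⟩

/-- If all Weyl points of the spectrum have finite ascent, then so do all B-Weyl points. -/
theorem exists_ker_pow_eq_of_isBWeyl
    (hT : ∀ ν ∈ spectrum ℂ T \ weylSpectrum T,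
      ∃ p : ℕ, (shift T ν ^ p).ker = (shift T ν ^ (p + 1)).ker)
    (hB : IsBWeyl (shift T μ)) :
    ∃ p : ℕ, (shift T μ ^ p).ker = (shift T μ ^ (p + 1)).ker := by
  refine hB.ascent_or_eventually_eigenvector.resolve_right fun hev => ?_
  -- z is chosen nonzero with a whole neighbourhood of eigenvalues of `shift T μ`, not merely as an
  -- eigenvalue itself.
  obtain ⟨z, ⟨hz, hW⟩, hz0⟩ := ((((eventually_eventually_nhds.2 hev).and
    hB.eventually_isWeyl).filter_mono nhdsWithin_le_nhds).and
    (self_mem_nhdsWithin : ∀ᶠ z : ℂ in 𝓝[≠] 0, z ≠ 0)).exists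
  have hW := hW hz0
  have hmem : μ + z ∈ spectrum ℂ T \ weylSpectrum T := by
    refine ⟨mem_spectrum_of_ker_ne_bot ?_, by
      rwa [notMem_weylSpectrum_iff, ← shift_sub_smul_id]⟩
    obtain ⟨y, hy0, hy⟩ := hz.self_of_nhds
    refine (Submodule.ne_bot_iff _).2 ⟨y, ?_, hy0⟩
    rw [← shift_sub_smul_id]
    exact sub_eq_zero.2 hy
  obtain ⟨p, hp⟩ := hT _ hmem
  rw [← shift_sub_smul_id] at hp
  have ht : Tendsto (fun v : ℂ => z + v) (𝓝 0) (𝓝 z) := by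
    simpa using (continuous_const_add z).tendsto 0
  -- Since z + v is an eigenvalue at μ, the small nonzero v is an eigenvalue at μ + z, which finite
  -- ascent there forbids.
  obtain ⟨v, ⟨hv, ⟨y, hy0, hy⟩⟩, hv0⟩ := ((((hW.eventually_injective_of_ascent hp).and
    (ht.eventually hz)).filter_mono nhdsWithin_le_nhds).and
    (self_mem_nhdsWithin : ∀ᶠ v : ℂ in 𝓝[≠] 0, v ≠ 0)).exists
  refine hy0 (hv hv0 y ?_)
  change shift T μ y - z • y = v • y
  rw [hy, add_smul, add_sub_cancel_left]

end Spectra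

end WeylType

/-! ### The equivalences -/

theorem theorem2 {X : Type*} [NormedAddCommGroup X] [NormedSpace ℂ X] [CompleteSpace X]
    (hX : ¬ FiniteDimensional ℂ X) (T : X →L[ℂ] X) :
    List.TFAE [
      WeylType.PropertyZPiA T,
      WeylType.PropertyGab T ∧ WeylType.bWeylSpectrum T = WeylType.weylSpectrum T,
      WeylType.PropertyAb T ∧ WeylType.leftPoles T = WeylType.leftPolesFiniteRank T,
      WeylType.PropertyBab T ∧ WeylType.leftPoles T = WeylType.leftPolesFiniteRank T,
      WeylType.BrowderTheorem T ∧ WeylType.leftPoles T = WeylType.polesFiniteRank T] := by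
  open WeylType in
  unfold PropertyZPiA PropertyGab PropertyAb PropertyBab BrowderTheorem
  have hfin : spectrum ℂ T \ weylSpectrum T = leftPoles T →
      leftPoles T = leftPolesFiniteRank T := fun h =>
    Set.Subset.antisymm (fun μ hμ => ⟨hμ, by
      rw [← h] at hμ
      exact (notMem_weylSpectrum_iff.1 hμ.2).1.finite_ker⟩) leftPolesFiniteRank_subset_leftPoles
  tfae_have 1 → 2 := fun h => by
    have hs : bWeylSpectrum T = weylSpectrum T := by
      refine bWeylSpectrum_subset_weylSpectrum.antisymm fun μ hμ => ?_
      by_contra hB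
      have hB := notMem_bWeylSpectrum_iff.1 hB
      have hσ : μ ∈ spectrum ℂ T := mem_spectrum_iff.2 fun hu => hμ (isWeyl_of_isUnit hu)
      have hl := mem_leftPoles_of_isBWeyl hσ hB (exists_ker_pow_eq_of_isBWeyl
        (fun ν hν => exists_ker_pow_eq_of_mem_leftPoles (h ▸ hν)) hB)
      rw [← h] at hl
      exact hl.2 hμ
    exact ⟨by rw [hs, h], hs⟩
  tfae_have 2 → 1 := fun ⟨h, hs⟩ => by rw [← hs, h]
  tfae_have 1 → 3 := fun h => ⟨h.trans (hfin h), hfin h⟩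
  tfae_have 3 → 1 := fun ⟨h, hs⟩ => h.trans hs.symm
  tfae_have 1 → 4 := fun h => ⟨(tfae_1_to_2 h).1.trans (hfin h), hfin h⟩
  tfae_have 4 → 1 := fun ⟨h, hs⟩ => by
    rw [← hs] at h
    refine Set.Subset.antisymm (fun μ hμ => ?_) fun μ hμ => ?_
    · exact h ▸ ⟨hμ.1, fun hB => hμ.2 (bWeylSpectrum_subset_weylSpectrum hB)⟩
    -- A left pole of finite rank that is B-Weyl has finite descent, so it is a pole of finite rank
    -- and hence a Weyl point.
    · have hk := (hs ▸ hμ : μ ∈ leftPolesFiniteRank T).2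
      have hB := h ▸ hμ
      exact polesFiniteRank_subset (mem_polesFiniteRank hB.1 (notMem_bWeylSpectrum_iff.1 hB.2)
        (exists_ker_pow_eq_of_mem_leftPoles hμ) hk)
  tfae_have 1 → 5 := fun h => by
    have hp : spectrum ℂ T \ weylSpectrum T = polesFiniteRank T := by
      refine Set.Subset.antisymm (fun μ hμ => ?_) polesFiniteRank_subset
      have hW := notMem_weylSpectrum_iff.1 hμ.2
      exact mem_polesFiniteRank hμ.1 hW.isBWeyl
        (exists_ker_pow_eq_of_mem_leftPoles (h ▸ hμ)) hW.1.finite_ker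
    exact ⟨hp, h.symm.trans hp⟩
  tfae_have 5 → 1 := fun ⟨h, hs⟩ => h.trans hs.symm
  tfae_finish
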